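/- \textbf{Conventions.} Let $R$ be a commutative ring of prime characteristic $p$. For $e\ge 0$, $F^e_*R$ denotes the additive group $R$ with the $R$-module structure $r\cdot F^e_*x=F^e_*(r^{p^e}x)$, and $R^\circ$ denotes the set of elements of $R$ lying in no minimal prime. An \emph{$F$-splitting} is an $R$-linear map $\varphi\colon F^e_*R\to R$ with $\varphi(F^e_*1)=1$. $R$ is \emph{strongly $F$-regular} if for every $d\in R^\circ$ there are $e>0$ and $\varphi\in\operatorname{Hom}_R(F^e_*R,R)$ with $\varphi(F^e_*d)=1$. For an ideal $\mathfrak a\subseteq R$ and a real number $t\ge 0$, an element $c\in R^\circ$ is a \emph{test element of $(R,\mathfrak a^t)$} if for every $d\in R^\circ$ there are $e>0$ and $\varphi\in\operatorname{Hom}_R(F^e_*R,R)$ with $c\in\varphi\bigl(F^e_*\,d\,\mathfrak a^{\lceil t(p^e-1)\rceil}\bigr)$, and the \emph{test ideal} is \[ \tau(\mathfrak a^t)=\sum_{e>0}\ \sum_{\varphi\in\operatorname{Hom}_R(F^e_*R,R)}\varphi\bigl(F^e_*\,c\,\mathfrak a^{\lceil t(p^e-1)\rceil}\bigr) \] for any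 test element $c$ of $(R,\mathfrak a^t)$; it does not depend on $c$. (If there is no test element, put $\tau(\mathfrak a^t)=0$.) For a $k$-algebra $R$ let $\mu\colon R\otimes_kR\to R$ be the multiplication map. The \emph{second diagonal Cartier algebra} $\mathscr D^{(2)}(R/k)$ is the graded ring whose piece of degree $e$ consists of the maps $\overline\varphi\colon F^e_*R\to R$ induced, via $\overline\varphi\circ F^e_*\mu=\mu\circ\varphi$, by the $R\otimes_kR$-linear maps $\varphi\colon F^e_*(R\otimes_kR)\to R\otimes_kR$ with $\varphi(F^e_*\ker\mu)\subseteq\ker\mu$. It is \emph{$F$-split} if for some $e>0$ its piece of degree $e$ contains an $F$-splitting of $R$. The ring $R$ is \emph{diagonally $F$-split over $k$} if for some $e>0$ there is an $F$-splitting $\varphi\colon F^e_*(R\otimes_kR)\to R\otimes_kR$ with $\varphi(F^e_*\ker\mu)\subseteq\ker\mu$. \textbf{Theorem A.} Let $k$ be a field of characteristic $p>0$ that is $F$-finite (that is, $F_*k$ is a finite-dimensional $k$-vector space), and let $R$ be a strongly $F$-regular $k$-algebra essentially of finite type. Suppose that $\mathscr D^{(2)}(R/k)$ is $F$-split; this holds,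 for example, if $R$ is diagonally $F$-split over $k$. Let $\mathfrak a\subseteq R$ be an ideal that is either zero or not contained in any minimal prime of $R$ (if $R$ is a domain, this is any ideal), and let $s,t>0$ be real numbers with $s+t\in\mathbb Z$. Then \[ \mathfrak a^{s+t}\subseteq\tau(\mathfrak a^{s-\epsilon})\,\tau(\mathfrak a^{t-\epsilon}) \qquad\text{for all }\epsilon\in(0,\min\{s,t\}]. \] -/

import Mathlib

open scoped TensorProduct

section FSingularities

variable {R : Type*} [CommRing R]

/-- An additive map `φ : R → R` viewed as a map `Fᵉ_* R → R` is `R`-linear. Here `Fᵉ_* R` is the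
additive group of `R` on which `r` acts as multiplication by `r ^ p ^ e`, so `R`-linearity reads
`φ (r ^ p ^ e * x) = r * φ x`. Thus the `φ` with this property form `Hom_R(Fᵉ_* R, R)`. -/
def IsFrobLinear (p e : ℕ) (φ : R →+ R) : Prop :=
  ∀ r x : R, φ (r ^ p ^ e * x) = r * φ x

/-- `φ` is an `F`-splitting `Fᵉ_* R → R`. -/
def IsFSplitting (p e : ℕ) (φ : R →+ R) : Prop :=
  IsFrobLinear p e φ ∧ φ 1 = 1

/-- `R°`: the elements of `R` that lie in no minimal prime. -/
def nonMinimal (R : Type*) [CommRing R] : Set R :=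
  {c | ∀ q ∈ minimalPrimes R, c ∉ q}

/-- `c` is a (big) test element of `R`. -/
def IsTestElement (p : ℕ) (c : R) : Prop :=
  c ∈ nonMinimal R ∧ ∀ d ∈ nonMinimal R,
    ∃ e > 0, ∃ φ : R →+ R, IsFrobLinear p e φ ∧ φ d = c

/-- `R` is strongly `F`-regular: `1` is a test element, i.e. for each `d ∈ R°` there are `e > 0` and
an `R`-linear map `Fᵉ_* R → R` that sends `Fᵉ_* d` to `1`. -/
def IsStronglyFRegular (p : ℕ) (R : Type*) [CommRing R] : Prop :=
  IsTestElement p (1 : R)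

/-- The ideal `𝔞 ^ ⌈t (pᵉ - 1)⌉`, for real `t ≥ 0`. -/
noncomputable def ceilPow (p : ℕ) (a : Ideal R) (t : ℝ) (e : ℕ) : Ideal R :=
  a ^ ⌈t * ((p : ℝ) ^ e - 1)⌉₊

/-- `c` is a test element of the pair `(R, 𝔞ᵗ)`. -/
def IsPairTestElement (p : ℕ) (a : Ideal R) (t : ℝ) (c : R) : Prop :=
  c ∈ nonMinimal R ∧ ∀ d ∈ nonMinimal R,
    ∃ e > 0, ∃ φ : R →+ R, IsFrobLinear p e φ ∧ ∃ x ∈ ceilPow p a t e, φ (d * x) = c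

/-- The sum of the ideals `φ(Fᵉ_* (c 𝔞 ^ ⌈t (pᵉ - 1)⌉))` over all `e > 0` and all
`φ ∈ Hom_R(Fᵉ_* R, R)`. -/
def testIdealOf (p : ℕ) (a : Ideal R) (t : ℝ) (c : R) : Ideal R :=
  Ideal.span {y | ∃ e > 0, ∃ φ : R →+ R, IsFrobLinear p e φ ∧ ∃ x ∈ ceilPow p a t e, φ (c * x) = y}

/-- The test ideal `τ(𝔞ᵗ)` of the pair `(R, 𝔞ᵗ)`. It is `testIdealOf p a t c` for any test element
`c` of the pair (`testIdeal_eq`); summing over all of them avoids a choice. -/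
def testIdeal (p : ℕ) (a : Ideal R) (t : ℝ) : Ideal R :=
  ⨆ (c : R) (_ : IsPairTestElement p a t c), testIdealOf p a t c

theorem IsFrobLinear.comp {p e d : ℕ} {φ ψ : R →+ R} (hφ : IsFrobLinear p e φ)
    (hψ : IsFrobLinear p d ψ) : IsFrobLinear p (e + d) (φ.comp ψ) := by
  intro r x
  simp only [AddMonoidHom.comp_apply]
  rw [pow_add, pow_mul, hψ, hφ]

theorem testIdealOf_le {p : ℕ} {a : Ideal R} {t : ℝ} {c c' : R}
    (hc : IsPairTestElement p a t c) (hc' : IsPairTestElement p a t c') :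
    testIdealOf p a t c' ≤ testIdealOf p a t c := by
  refine Ideal.span_le.2 ?_
  rintro y ⟨e', he', φ', hφ', x', hx', rfl⟩
  obtain ⟨e, he, φ, hφ, x, hx, hxc⟩ := hc'.2 c hc.1
  refine Ideal.subset_span ⟨e' + e, by omega, φ'.comp φ, hφ'.comp hφ, x * x' ^ p ^ e, ?_, ?_⟩
  · have h1 := Ideal.mul_mem_mul hx (Ideal.pow_mem_pow hx' (p ^ e))
    unfold ceilPow at *
    rw [← pow_mul, ← pow_add] at h1
    refine Ideal.pow_le_pow_right (Nat.ceil_le.2 ?_) h1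
    have hpe : (0 : ℝ) ≤ (p : ℝ) ^ e := by positivity
    have h2 := Nat.le_ceil (t * ((p : ℝ) ^ e - 1))
    have h3 := mul_le_mul_of_nonneg_right (Nat.le_ceil (t * ((p : ℝ) ^ e' - 1))) hpe
    push_cast
    rw [pow_add]
    nlinarith
  · have h4 : c * (x * x' ^ p ^ e) = x' ^ p ^ e * (c * x) := by ring
    rw [AddMonoidHom.comp_apply, h4, hφ, hxc, mul_comm]

theorem testIdeal_eq {p : ℕ} {a : Ideal R} {t : ℝ} {c : R}
    (hc : IsPairTestElement p a t c) : testIdeal p a t = testIdealOf p a t c :=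
  le_antisymm (iSup₂_le fun _ h => testIdealOf_le hc h)
    (le_iSup₂_of_le c hc le_rfl)

/-- A Cartier algebra on `R`: a graded subring of `⨁ₑ Hom_R(Fᵉ_* R, R)`, given by its graded pieces,
whose degree zero piece is all of `Hom_R(R, R)`. -/
structure CartierAlgebra (p : ℕ) (R : Type*) [CommRing R] where
  piece : ℕ → AddSubgroup (R →+ R)
  isFrobLinear : ∀ {e : ℕ} {φ : R →+ R}, φ ∈ piece e → IsFrobLinear p e φ
  mem_piece_zero : ∀ {φ : R →+ R}, IsFrobLinear p 0 φ → φ ∈ piece 0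
  comp_mem : ∀ {e d : ℕ} {φ ψ : R →+ R}, φ ∈ piece e → ψ ∈ piece d → φ.comp ψ ∈ piece (e + d)

/-- A Cartier algebra is `F`-split if it contains an `F`-splitting of some positive degree. -/
def CartierAlgebra.IsFSplit {p : ℕ} (D : CartierAlgebra p R) : Prop :=
  ∃ e > 0, ∃ φ ∈ D.piece e, IsFSplitting p e φ

/-- The Cartier algebra on `R` of the maps `φ` compatible with `I`, i.e. `φ(Fᵉ_* I) ⊆ I`. -/
def CartierAlgebra.compatible (p : ℕ) (I : Ideal R) : CartierAlgebra p R where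
  piece e :=
    { carrier := {φ | IsFrobLinear p e φ ∧ ∀ x ∈ I, φ x ∈ I}
      zero_mem' := ⟨fun r x => by simp, fun x _ => by simp⟩
      add_mem' := fun {φ ψ} hφ hψ =>
        ⟨fun r x => by simp [hφ.1 r x, hψ.1 r x, mul_add],
          fun x hx => I.add_mem (hφ.2 x hx) (hψ.2 x hx)⟩
      neg_mem' := fun {φ} hφ =>
        ⟨fun r x => by simp [hφ.1 r x], fun x hx => I.neg_mem (hφ.2 x hx)⟩ }
  isFrobLinear h := h.1
  mem_piece_zero {φ} h := ⟨h, fun x hx => by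
    have h1 := h x 1
    rw [pow_zero, pow_one, mul_one] at h1
    rw [h1]
    exact I.mul_mem_right _ hx⟩
  comp_mem hφ hψ := ⟨hφ.1.comp hψ.1, fun x hx => hφ.2 _ (hψ.2 x hx)⟩

/-- For a surjective ring map `π : S → R`, which identifies `S ⧸ ker π` with `R`, the restriction to
`R` of the Cartier algebra on `S` of maps compatible with `ker π`: it consists of the maps induced
on `R` by maps `φ` on `S` compatible with `ker π`. -/
def CartierAlgebra.restrict (p : ℕ) {S : Type*} [CommRing S] (π : S →+* R)
    (hπ : Function.Surjective π) : CartierAlgebra p R where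
  piece e :=
    { carrier := {ψ | ∃ φ ∈ (CartierAlgebra.compatible p (RingHom.ker π)).piece e,
        ∀ x, ψ (π x) = π (φ x)}
      zero_mem' := ⟨0, zero_mem _, fun x => by simp⟩
      add_mem' := by
        rintro _ _ ⟨φ, hφ, h⟩ ⟨φ', hφ', h'⟩
        exact ⟨φ + φ', add_mem hφ hφ', fun x => by simp [h, h']⟩
      neg_mem' := by
        rintro _ ⟨φ, hφ, h⟩
        exact ⟨-φ, neg_mem hφ, fun x => by simp [h]⟩ }
  isFrobLinear := by
    rintro e ψ ⟨φ, hφ, h⟩ r x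
    obtain ⟨r, rfl⟩ := hπ r
    obtain ⟨x, rfl⟩ := hπ x
    rw [← map_pow, ← map_mul, h, h, hφ.1, map_mul]
  mem_piece_zero := by
    intro ψ hψ
    obtain ⟨s, hs⟩ := hπ (ψ 1)
    refine ⟨AddMonoidHom.mulLeft s, CartierAlgebra.mem_piece_zero _ fun r x => ?_, fun x => ?_⟩
    · simp only [pow_zero, pow_one, AddMonoidHom.coe_mulLeft]
      ring
    · have h1 := hψ (π x) 1
      rw [pow_zero, pow_one, mul_one] at h1
      rw [h1, AddMonoidHom.coe_mulLeft, map_mul, hs, mul_comm]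
  comp_mem := by
    rintro e d _ _ ⟨φ, hφ, h⟩ ⟨φ', hφ', h'⟩
    exact ⟨φ.comp φ', CartierAlgebra.comp_mem _ hφ hφ', fun x => by simp [h, h']⟩

end FSingularities

section Diagonal

variable (p : ℕ) (k R : Type*) [CommRing k] [CommRing R] [Algebra k R]

/-- The multiplication map `μ : R ⊗ R → R`, `x ⊗ y ↦ x y`. -/
def diagMul : R ⊗[k] R →+* R :=
  (Algebra.TensorProduct.lmul' k : R ⊗[k] R →ₐ[k] R).toRingHom

theorem diagMul_surjective : Function.Surjective (diagMul k R) := fun x =>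
  ⟨x ⊗ₜ 1, by simp [diagMul]⟩

/-- `R` is diagonally `F`-split over `k`: `R ⊗ R` is `F`-split compatibly with `ker μ`. -/
def IsDiagonallyFSplit : Prop :=
  (CartierAlgebra.compatible p (RingHom.ker (diagMul k R))).IsFSplit

/-- The second diagonal Cartier algebra `𝒟⁽²⁾(R/k)`. -/
def secondDiagonalCartierAlgebra : CartierAlgebra p R :=
  CartierAlgebra.restrict p (diagMul k R) (diagMul_surjective k R)

end Diagonal

/-! For an ideal `𝔟` write `C_e(𝔟)` for the sum of the ideals `φ(Fᵉ_* 𝔟)` over all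
`φ ∈ Hom_R(Fᵉ_* R, R)`. Two facts give the theorem.

* *Subadditivity.* A map `ψ` of degree `e` in `𝒟⁽²⁾(R/k)` sends `𝔟𝔠` into `C_e(𝔟) C_e(𝔠)`. Indeed,
  `ψ` is induced by a map `φ` on `R ⊗ R`. Since `R ⊗ R` is projective over either factor, `φ` sends
  `𝔟 ⊗ R` into `C_e(𝔟) ⊗ R` and `R ⊗ 𝔠` into `R ⊗ C_e(𝔠)`. Over a field these two ideals meet in
  their product, which multiplication maps onto `C_e(𝔟) C_e(𝔠)`.
* *Strong `F`-regularity* gives `C_e(𝔞 ^ m) ⊆ τ(𝔞ᵗ)` as soon as `t pᵉ ≤ m`.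

If `s + t < n`, then `⌈s pᵉ⌉ + ⌈t pᵉ⌉ ≤ n pᵉ` for large `e`, so for `x ∈ 𝔞 ^ n` the power `x ^ pᵉ`
lies in `𝔞 ^ ⌈s pᵉ⌉ 𝔞 ^ ⌈t pᵉ⌉`, and an `F`-splitting in `𝒟⁽²⁾(R/k)` sends it back to `x`.
-/

open Filter

section CartierImage

variable {p e : ℕ} {A : Type*} [CommRing A]

/-- The ideal `∑ φ(Fᵉ_* 𝔟)`, over all `φ ∈ Hom_A(Fᵉ_* A, A)`. If `A` is regular and `F`-finite, this
is the Frobenius root usually denoted `𝔟^[1/pᵉ]`. -/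
def cartierImage (p e : ℕ) (b : Ideal A) : Ideal A :=
  Ideal.span {y | ∃ φ : A →+ A, IsFrobLinear p e φ ∧ ∃ x ∈ b, φ x = y}

theorem IsFrobLinear.apply_mem_cartierImage {φ : A →+ A} (hφ : IsFrobLinear p e φ) {b : Ideal A}
    {x : A} (hx : x ∈ b) : φ x ∈ cartierImage p e b :=
  Ideal.subset_span ⟨φ, hφ, x, hx, rfl⟩

theorem cartierImage_le_iff {b I : Ideal A} :
    cartierImage p e b ≤ I ↔ ∀ φ : A →+ A, IsFrobLinear p e φ → ∀ x ∈ b, φ x ∈ I := by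
  refine ⟨fun h φ hφ x hx => h (hφ.apply_mem_cartierImage hx), fun h => Ideal.span_le.2 ?_⟩
  rintro _ ⟨φ, hφ, x, hx, rfl⟩
  exact h φ hφ x hx

variable {T : Type*} [CommRing T] [Algebra A T]

theorem IsFrobLinear.linearMap_comp_comp_toSpanSingleton {φ : T →+ T} (hφ : IsFrobLinear p e φ)
    (f : T →ₗ[A] A) (y : T) : IsFrobLinear p e
      ((f.toAddMonoidHom.comp φ).comp (LinearMap.toSpanSingleton A T y).toAddMonoidHom) := by
  intro r x
  have hφ_smul : φ ((r ^ p ^ e * x) • y) = r • φ (x • y) := by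
    rw [mul_smul, Algebra.smul_def, map_pow, hφ, ← Algebra.smul_def]
  simp [hφ_smul]

theorem cartierImage_map_le [Module.Projective A T] (b : Ideal A) :
    cartierImage p e (b.map (algebraMap A T)) ≤ (cartierImage p e b).map (algebraMap A T) := by
  obtain ⟨coord, hcoord⟩ := (Module.projective_def (R := A) (P := T)).1 inferInstance
  refine cartierImage_le_iff.2 fun φ hφ z hz => ?_
  have apply_smul_mem (y : T) {u : A} (hu : u ∈ b) :
      φ (u • y) ∈ (cartierImage p e b).map (algebraMap A T) := by
    rw [← hcoord (φ (u • y)), Finsupp.linearCombination_apply]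
    refine Ideal.sum_mem _ fun j _ => ?_
    change coord (φ (u • y)) j • j ∈ _
    rw [Algebra.smul_def]
    exact Ideal.mul_mem_right _ _ (Ideal.mem_map_of_mem (algebraMap A T)
      ((hφ.linearMap_comp_comp_toSpanSingleton
        (Finsupp.lapply j ∘ₗ coord) y).apply_mem_cartierImage hu))
  rw [← Submodule.restrictScalars_mem A, ← Ideal.smul_top_eq_map] at hz
  refine Submodule.smul_induction_on hz (fun u hu y _ => apply_smul_mem y hu) fun y y' hy hy' => ?_
  rw [map_add]
  exact add_mem hy hy'

end CartierImage

section TensorProduct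

open Algebra.TensorProduct

theorem cartierImage_map_includeLeft_le {p e : ℕ} {k A B : Type*} [CommRing k] [CommRing A]
    [CommRing B] [Algebra k A] [Algebra k B] [Module.Projective k B] (b : Ideal A) :
    cartierImage p e (b.map (includeLeft : A →ₐ[k] A ⊗[k] B)) ≤
      (cartierImage p e b).map (includeLeft : A →ₐ[k] A ⊗[k] B) :=
  cartierImage_map_le b

theorem cartierImage_map_includeRight_le {p e : ℕ} {k A B : Type*} [CommRing k] [CommRing A]
    [CommRing B] [Algebra k A] [Algebra k B] [Module.Projective k A] (b : Ideal B) :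
    cartierImage p e (b.map (includeRight : B →ₐ[k] A ⊗[k] B)) ≤
      (cartierImage p e b).map (includeRight : B →ₐ[k] A ⊗[k] B) :=
  letI : Algebra B (A ⊗[k] B) := rightAlgebra
  have : Module.Projective B (A ⊗[k] B) :=
    Module.Projective.of_equiv (commRight k B A).toLinearEquiv
  cartierImage_map_le b

theorem map_includeLeft_inf_map_includeRight_le_mul {k A B : Type*} [Field k] [CommRing A]
    [CommRing B] [Algebra k A] [Algebra k B] (I : Ideal A) (J : Ideal B) :
    I.map (includeLeft : A →ₐ[k] A ⊗[k] B) ⊓ J.map (includeRight : B →ₐ[k] A ⊗[k] B) ≤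
      I.map (includeLeft : A →ₐ[k] A ⊗[k] B) * J.map (includeRight : B →ₐ[k] A ⊗[k] B) := by
  rintro z ⟨hzI, hzJ⟩
  obtain ⟨f, hf⟩ := (J.restrictScalars k).subtype.exists_leftInverse_of_injective
    (Submodule.ker_subtype _)
  let JR := J.map (includeRight : B →ₐ[k] A ⊗[k] B)
  -- A projection onto `A ⊗ J` that is `A`-linear, so that it preserves `I ⊗ B`.
  let π : A ⊗[k] B →ₗ[A] A ⊗[k] B :=
    TensorProduct.AlgebraTensorModule.lTensor A A ((J.restrictScalars k).subtype ∘ₗ f)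
  have hJR : JR.restrictScalars k = LinearMap.range ((J.restrictScalars k).subtype.lTensor A) :=
    J.map_includeRight_eq
  have hπz : π z = z := by
    obtain ⟨w, rfl⟩ := hJR.le hzJ
    change ((J.restrictScalars k).subtype ∘ₗ f).lTensor A _ = _
    rw [← LinearMap.lTensor_comp_apply, LinearMap.comp_assoc, hf, LinearMap.comp_id]
  have hπ_range : (⊤ : Submodule A (A ⊗[k] B)).map π ≤ JR.restrictScalars A := by
    rintro _ ⟨w, -, rfl⟩
    exact hJR.ge ⟨f.lTensor A w, (LinearMap.lTensor_comp_apply A _ f w).symm⟩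
  have hz : z ∈ I • (⊤ : Submodule A (A ⊗[k] B)) := by
    rw [Ideal.smul_top_eq_map]
    exact hzI
  have hπz_mem : π z ∈ I • JR.restrictScalars A := by
    refine Submodule.smul_mono le_rfl hπ_range ?_
    rw [← Submodule.map_smul'']
    exact Submodule.mem_map_of_mem hz
  rwa [hπz, ← Ideal.smul_restrictScalars] at hπz_mem

end TensorProduct

section DiagonalCartierAlgebra

open Algebra.TensorProduct

theorem map_diagMul_map_includeLeft_mul_map_includeRight {k R : Type*} [CommRing k] [CommRing R]
    [Algebra k R] (I J : Ideal R) :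
    (I.map (includeLeft : R →ₐ[k] R ⊗[k] R) * J.map (includeRight : R →ₐ[k] R ⊗[k] R)).map
      (diagMul k R) = I * J := by
  change Ideal.map (lmul' k : R ⊗[k] R →ₐ[k] R) _ = _
  rw [Ideal.map_mul, Ideal.map_mapₐ, Ideal.map_mapₐ, lmul'_comp_includeLeft,
    lmul'_comp_includeRight]
  exact congrArg₂ _ I.map_id J.map_id

theorem apply_mem_cartierImage_mul_of_mem_secondDiagonal {p e : ℕ} {k R : Type*} [Field k]
    [CommRing R] [Algebra k R] {ψ : R →+ R}
    (hψ : ψ ∈ (secondDiagonalCartierAlgebra p k R).piece e) {b c : Ideal R} {x : R}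
    (hx : x ∈ b * c) : ψ x ∈ cartierImage p e b * cartierImage p e c := by
  obtain ⟨φ, ⟨hφ, -⟩, hφψ⟩ := hψ
  rw [← map_diagMul_map_includeLeft_mul_map_includeRight (k := k),
    Ideal.mem_map_iff_of_surjective _ (diagMul_surjective k R)] at hx
  obtain ⟨z, hz, rfl⟩ := hx
  have hleft : φ z ∈ (cartierImage p e b).map (includeLeft : R →ₐ[k] R ⊗[k] R) :=
    cartierImage_map_includeLeft_le b (hφ.apply_mem_cartierImage (Ideal.mul_le_left hz))
  have hright : φ z ∈ (cartierImage p e c).map (includeRight : R →ₐ[k] R ⊗[k] R) :=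
    cartierImage_map_includeRight_le c (hφ.apply_mem_cartierImage (Ideal.mul_le_right hz))
  rw [hφψ, ← map_diagMul_map_includeLeft_mul_map_includeRight (k := k)]
  exact Ideal.mem_map_of_mem _ (map_includeLeft_inf_map_includeRight_le_mul _ _ ⟨hleft, hright⟩)

end DiagonalCartierAlgebra

section FSplitting

variable {p e d : ℕ} {R : Type*} [CommRing R]

theorem IsFSplitting.comp {φ ψ : R →+ R} (hφ : IsFSplitting p e φ) (hψ : IsFSplitting p d ψ) :
    IsFSplitting p (e + d) (φ.comp ψ) :=
  ⟨hφ.1.comp hψ.1, by rw [AddMonoidHom.comp_apply, hψ.2, hφ.2]⟩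

theorem IsFSplitting.apply_pow {φ : R →+ R} (hφ : IsFSplitting p e φ) (x : R) :
    φ (x ^ p ^ e) = x := by
  rw [← mul_one (x ^ p ^ e), hφ.1, hφ.2, mul_one]

theorem CartierAlgebra.IsFSplit.frequently_exists_isFSplitting {D : CartierAlgebra p R}
    (hD : D.IsFSplit) : ∃ᶠ e in atTop, ∃ φ ∈ D.piece e, IsFSplitting p e φ := by
  obtain ⟨e, he, φ, hφ, hφs⟩ := hD
  refine frequently_atTop.2 fun N => ?_
  induction N with
  | zero => exact ⟨e, e.zero_le, φ, hφ, hφs⟩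
  | succ N ih =>
    obtain ⟨d, hd, ψ, hψ, hψs⟩ := ih
    exact ⟨e + d, by lia, φ.comp ψ, D.comp_mem hφ hψ, hφs.comp hψs⟩

variable {S : Type*} [CommRing S] {π : S →+* R}

theorem CartierAlgebra.exists_mem_piece_restrict (hπ : Function.Surjective π) {φ : S →+ S}
    (hφ : φ ∈ (CartierAlgebra.compatible p (RingHom.ker π)).piece e) :
    ∃ ψ ∈ (CartierAlgebra.restrict p π hπ).piece e, ∀ x, ψ (π x) = π (φ x) := by
  let g : {g : S →+ R // (π : S →+ R).ker ≤ g.ker} := ⟨(π : S →+ R).comp φ, hφ.2⟩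
  have hlift := (π : S →+ R).liftOfRightInverse_comp_apply _ (Function.rightInverse_surjInv hπ) g
  exact ⟨(π : S →+ R).liftOfSurjective hπ g, ⟨φ, hφ, hlift⟩, hlift⟩

theorem CartierAlgebra.IsFSplit.restrict (hπ : Function.Surjective π)
    (h : (CartierAlgebra.compatible p (RingHom.ker π)).IsFSplit) :
    (CartierAlgebra.restrict p π hπ).IsFSplit := by
  obtain ⟨e, he, φ, hφ, -, hφ_one⟩ := h
  obtain ⟨ψ, hψ, hψφ⟩ := CartierAlgebra.exists_mem_piece_restrict hπ hφ
  refine ⟨e, he, ψ, hψ, CartierAlgebra.isFrobLinear _ hψ, ?_⟩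
  rw [← map_one π, hψφ, hφ_one]

end FSplitting

section TestIdeal

variable {p : ℕ} {R : Type*} [CommRing R] {a : Ideal R}

theorem pow_mem_nonMinimal {b : R} (hb : b ∈ nonMinimal R) (m : ℕ) : b ^ m ∈ nonMinimal R :=
  fun q hq h => hb q hq (hq.1.1.mem_of_pow_mem m h)

theorem exists_mem_nonMinimal (hfin : (minimalPrimes R).Finite)
    (ha : ∀ q ∈ minimalPrimes R, ¬ a ≤ q) : ∃ b ∈ a, b ∈ nonMinimal R := by
  have not_subset : ¬ (a : Set R) ⊆ ⋃ q ∈ minimalPrimes R, q := by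
    rw [Ideal.subset_union_prime_finite hfin ⊥ ⊥ fun q hq _ _ => hq.1.1]
    rintro ⟨q, hq, haq⟩
    exact ha q hq haq
  obtain ⟨b, hba, hb⟩ := Set.not_subset.1 not_subset
  exact ⟨b, hba, fun q hq hbq => hb (Set.mem_biUnion hq hbq)⟩

theorem pow_le_ceilPow {t : ℝ} (ht : 0 ≤ t) {e m : ℕ} (hm : t * (p : ℝ) ^ e ≤ m) :
    a ^ m ≤ ceilPow p a t e :=
  Ideal.pow_le_pow_right (Nat.ceil_le.2 (by linarith))

theorem pow_mem_ceilPow_add {t : ℝ} (ht : 0 ≤ t) {e m : ℕ} (hm : t * (p : ℝ) ^ e ≤ m) (d : ℕ)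
    {x : R} (hx : x ∈ a ^ m) : x ^ p ^ d ∈ ceilPow p a t (e + d) := by
  refine pow_le_ceilPow (m := m * p ^ d) ht ?_ ?_
  · calc t * (p : ℝ) ^ (e + d) = t * (p : ℝ) ^ e * (p : ℝ) ^ d := by ring
      _ ≤ m * (p : ℝ) ^ d := by gcongr
      _ = ↑(m * p ^ d) := by push_cast; rfl
  · rw [pow_mul]
    exact Ideal.pow_mem_pow hx _

theorem IsStronglyFRegular.isPairTestElement_pow (hR : IsStronglyFRegular p R) {b : R}
    (hba : b ∈ a) (hb : b ∈ nonMinimal R) {t : ℝ} (ht : 0 ≤ t) :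
    IsPairTestElement p a t (b ^ ⌈t⌉₊) := by
  refine ⟨pow_mem_nonMinimal hb _, fun d hd => ?_⟩
  obtain ⟨e, he, φ, hφ, hφd⟩ := hR.2 d hd
  refine ⟨e, he, φ, hφ, (b ^ ⌈t⌉₊) ^ p ^ e, ?_, ?_⟩
  · simpa using pow_mem_ceilPow_add (p := p) (e := 0) ht (by simpa using Nat.le_ceil t) e
      (Ideal.pow_mem_pow hba ⌈t⌉₊)
  · rw [mul_comm, hφ, hφd, mul_one]

theorem IsStronglyFRegular.cartierImage_pow_le_testIdeal (hR : IsStronglyFRegular p R) {b : R}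
    (hba : b ∈ a) (hb : b ∈ nonMinimal R) {t : ℝ} (ht : 0 ≤ t) {e m : ℕ}
    (hm : t * (p : ℝ) ^ e ≤ m) : cartierImage p e (a ^ m) ≤ testIdeal p a t := by
  refine cartierImage_le_iff.2 fun φ hφ x hx => ?_
  have hc := hR.isPairTestElement_pow hba hb ht
  obtain ⟨d, hd, ψ, hψ, hψc⟩ := hR.2 _ hc.1
  rw [testIdeal_eq hc]
  -- Precomposing with `ψ` absorbs the test element: `φ (ψ (c * x ^ pᵈ)) = φ (x * ψ c) = φ x`.
  refine Ideal.subset_span ⟨e + d, by lia, φ.comp ψ, hφ.comp hψ, x ^ p ^ d,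
    pow_mem_ceilPow_add ht hm d hx, ?_⟩
  rw [AddMonoidHom.comp_apply, mul_comm, hψ, hψc, mul_one]

end TestIdeal

theorem eventually_ceil_add_ceil_le {s t r : ℝ} (hs : 0 ≤ s) (ht : 0 ≤ t) (hst : s + t < r) :
    ∀ᶠ q : ℝ in atTop, (⌈s * q⌉₊ + ⌈t * q⌉₊ : ℝ) ≤ r * q := by
  have hgap : Tendsto (fun q : ℝ => (r - (s + t)) * q) atTop atTop :=
    tendsto_id.const_mul_atTop (sub_pos.2 hst)
  filter_upwards [eventually_ge_atTop 0, hgap.eventually_ge_atTop 2] with q hq hgap_q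
  have hs_ceil := Nat.ceil_lt_add_one (mul_nonneg hs hq)
  have ht_ceil := Nat.ceil_lt_add_one (mul_nonneg ht hq)
  linarith

theorem theoremA_general (p : ℕ) [Fact p.Prime] {k R : Type*} [Field k] [CharP k p] [CommRing R]
    [Algebra k R] (hfin : (minimalPrimes R).Finite) (hR : IsStronglyFRegular p R)
    (hD : (secondDiagonalCartierAlgebra p k R).IsFSplit) {a : Ideal R}
    (ha : a = ⊥ ∨ ∀ q ∈ minimalPrimes R, ¬ a ≤ q) {s t : ℝ} (hs : 0 ≤ s) (ht : 0 ≤ t) {n : ℕ}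
    (hst : s + t < n) : a ^ n ≤ testIdeal p a s * testIdeal p a t := by
  rcases ha with rfl | ha
  · have hn : n ≠ 0 := by rintro rfl; norm_num at hst; linarith
    exact (Ideal.pow_le_self hn).trans bot_le
  obtain ⟨b, hba, hb⟩ := exists_mem_nonMinimal hfin ha
  have hp : (1 : ℝ) < p := mod_cast (Fact.out : p.Prime).one_lt
  have hceil := (tendsto_pow_atTop_atTop_of_one_lt hp).eventually
    (eventually_ceil_add_ceil_le hs ht hst)
  obtain ⟨e, ⟨ψ, hψ, hψs⟩, he⟩ :=
    (hD.frequently_exists_isFSplitting.and_eventually hceil).exists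
  intro x hx
  have hxq : x ^ p ^ e ∈ a ^ ⌈s * (p : ℝ) ^ e⌉₊ * a ^ ⌈t * (p : ℝ) ^ e⌉₊ := by
    rw [← pow_add]
    refine Ideal.pow_le_pow_right (mod_cast he) ?_
    rw [pow_mul]
    exact Ideal.pow_mem_pow hx _
  rw [← hψs.apply_pow x]
  exact Ideal.mul_mono (hR.cartierImage_pow_le_testIdeal hba hb hs (Nat.le_ceil _))
    (hR.cartierImage_pow_le_testIdeal hba hb ht (Nat.le_ceil _))
    (apply_mem_cartierImage_mul_of_mem_secondDiagonal hψ hxq)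

theorem theoremA (p : ℕ) [Fact p.Prime] {k R : Type*} [Field k] [CharP k p]
    (hk : (frobenius k p).Finite) [CommRing R] [Algebra k R] [Algebra.EssFiniteType k R]
    (hR : IsStronglyFRegular p R) :
    (IsDiagonallyFSplit p k R → (secondDiagonalCartierAlgebra p k R).IsFSplit) ∧
    ((secondDiagonalCartierAlgebra p k R).IsFSplit →
      ∀ a : Ideal R, (a = ⊥ ∨ ∀ q ∈ minimalPrimes R, ¬ a ≤ q) →
      ∀ s t : ℝ, 0 < s → 0 < t → ∀ n : ℕ, s + t = n →
      ∀ ε : ℝ, 0 < ε → ε ≤ min s t →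
        a ^ n ≤ testIdeal p a (s - ε) * testIdeal p a (t - ε)) := by
  have : IsNoetherianRing R := Algebra.EssFiniteType.isNoetherianRing k R
  exact ⟨fun h => h.restrict (diagMul_surjective k R), fun hD a ha s t _ _ n hn ε hε hεst =>
    theoremA_general p (minimalPrimes.finite_of_isNoetherianRing R) hR hD ha
      (sub_nonneg.2 (le_min_iff.1 hεst).1) (sub_nonneg.2 (le_min_iff.1 hεst).2) (by linarith)⟩
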